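/- Let $\mathfrak g=\mathfrak g_{5,4}$ be the $3$-step nilpotent real Lie algebra with basis $X_1,\dots,X_5$ and commutation relations $[X_5,X_4]=X_3$, $[X_5,X_3]=X_2$, $[X_4,X_3]=X_1$ (all other brackets $[X_i,X_j]$ with $i>j$ being $0$). Let $\mathfrak z$ be its centre and let $G$ be the connected and simply connected Lie group with Lie algebra $\mathfrak g$, acting on the dual $\mathfrak g^*$ by the coadjoint action. For $\xi\in\mathfrak g^*$ put $\xi_j:=\langle\xi,X_j\rangle$, and for a linear subspace $S\subseteq\mathfrak g$ put $S^\perp:=\{\xi\in\mathfrak g^*\mid \xi|_S=0\}$. The coadjoint orbit $G\xi$ is $2$-dimensional if and only if $\xi\in\mathfrak g^*\setminus[\mathfrak g,\mathfrak g]^\perp$. Moreover: (i) The polynomial function $C\colon\mathfrak g^*\to\mathbb R$, $C(\xi):=2\xi_1\xi_5-2\xi_2\xi_4+\xi_3^2$, is constant on the coadjoint orbits in $\mathfrak g^*$. (ii) Let $(\mathfrak g^*\setminus[\mathfrak g,\mathfrak g]^\perp)/G$ be the space of $2$-dimensional coadjoint orbits with its quotient topology. The mapping $$\Psi\colon(\mathfrak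 g^*\setminus[\mathfrak g,\mathfrak g]^\perp)/G\to\bigl((\mathfrak z^*\setminus\{0\})\times\mathbb R\bigr)\cup\bigl(\{0\}\times(0,\infty)\bigr)\subseteq\mathfrak z^*\times\mathbb R,\qquad \Psi(G\xi)=(\xi|_{\mathfrak z},C(\xi)),$$ is well defined, continuous, open, and surjective. Moreover, for any orbit $\mathcal O\in(\mathfrak g^*\setminus[\mathfrak g,\mathfrak g]^\perp)/G$ we have $\{\mathcal O\}\neq\Psi^{-1}(\Psi(\mathcal O))$ if and only if $\mathcal O\subseteq\mathfrak z^\perp$, and if this is the case, then $\Psi^{-1}(\Psi(\mathcal O))=\{\mathcal O,-\mathcal O\}$. -/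

import Mathlib

open scoped Pointwise

noncomputable section

set_option linter.unusedSimpArgs false

/-- The underlying five-dimensional real vector space of the Lie algebra `𝔤₅,₄`. The vector with
coordinates `x 0, …, x 4` is `x 0 • X₁ + x 1 • X₂ + x 2 • X₃ + x 3 • X₄ + x 4 • X₅`. -/
def Lie54 : Type := Fin 5 → ℝ

namespace Lie54

instance : NormedAddCommGroup Lie54 := inferInstanceAs (NormedAddCommGroup (Fin 5 → ℝ))
instance : NormedSpace ℝ Lie54 := inferInstanceAs (NormedSpace ℝ (Fin 5 → ℝ))
instance : FiniteDimensional ℝ Lie54 := inferInstanceAs (FiniteDimensional ℝ (Fin 5 → ℝ))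

/-- The basis vector `X (j - 1)` is the vector called `X_j`, for `j = 1, …, 5`. -/
def X (j : Fin 5) : Lie54 := fun i => if i = j then 1 else 0

/-- The bracket with `[X₅, X₄] = X₃`, `[X₅, X₃] = X₂`, `[X₄, X₃] = X₁`, all other brackets of
basis vectors (up to skew-symmetry) being zero. -/
instance : Bracket Lie54 Lie54 where
  bracket x y := ![x 3 * y 2 - x 2 * y 3, x 4 * y 2 - x 2 * y 4, x 4 * y 3 - x 3 * y 4, 0, 0]

@[simp] theorem lie_apply_0 (x y : Lie54) : ⁅x, y⁆ 0 = x 3 * y 2 - x 2 * y 3 := rfl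
@[simp] theorem lie_apply_1 (x y : Lie54) : ⁅x, y⁆ 1 = x 4 * y 2 - x 2 * y 4 := rfl
@[simp] theorem lie_apply_2 (x y : Lie54) : ⁅x, y⁆ 2 = x 4 * y 3 - x 3 * y 4 := rfl
@[simp] theorem lie_apply_3 (x y : Lie54) : ⁅x, y⁆ 3 = 0 := rfl
@[simp] theorem lie_apply_4 (x y : Lie54) : ⁅x, y⁆ 4 = 0 := rfl

theorem ext5 {x y : Lie54} (h0 : x 0 = y 0) (h1 : x 1 = y 1) (h2 : x 2 = y 2) (h3 : x 3 = y 3)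
    (h4 : x 4 = y 4) : x = y := by
  funext i
  fin_cases i
  exacts [h0, h1, h2, h3, h4]

@[simp] theorem add_apply (x y : Lie54) (i : Fin 5) : (x + y) i = x i + y i := rfl
@[simp] theorem neg_apply (x : Lie54) (i : Fin 5) : (-x) i = -x i := rfl
@[simp] theorem zero_apply (i : Fin 5) : (0 : Lie54) i = 0 := rfl
@[simp] theorem smul_apply (c : ℝ) (x : Lie54) (i : Fin 5) : (c • x) i = c * x i := rfl

instance : LieRing Lie54 where
  add_lie x y z := by apply ext5 <;> simp <;> ring
  lie_add x y z := by apply ext5 <;> simp <;> ring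
  lie_self x := by apply ext5 <;> simp <;> ring
  leibniz_lie x y z := by apply ext5 <;> simp <;> ring

instance : LieAlgebra ℝ Lie54 where
  lie_smul c x y := by apply ext5 <;> simp <;> ring

theorem lie_X4_X3 : ⁅X 4, X 3⁆ = X 2 := by
  apply ext5 <;> simp [X]

theorem lie_X4_X2 : ⁅X 4, X 2⁆ = X 1 := by
  apply ext5 <;> simp [X]

theorem lie_X3_X2 : ⁅X 3, X 2⁆ = X 0 := by
  apply ext5 <;> simp [X]

theorem lie_lie_lie (x y z w : Lie54) : ⁅x, ⁅y, ⁅z, w⁆⁆⁆ = 0 := by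
  apply ext5 <;> simp

/-- The linear dual `𝔤*`, with its vector space topology. (All linear functionals on the
finite-dimensional space `𝔤` are continuous.) -/
abbrev DualSp : Type := StrongDual ℝ Lie54

/-- The annihilator `S^⊥ ⊆ 𝔤*` of a linear subspace `S ⊆ 𝔤`. -/
def annihilator (S : Submodule ℝ Lie54) : Set DualSp := {ξ | ∀ x ∈ S, ξ x = 0}

/-- The centre `𝔷` of `𝔤`, as a linear subspace. -/
abbrev centre : Submodule ℝ Lie54 := (LieAlgebra.center ℝ Lie54).toSubmodule

/-- The derived algebra `[𝔤, 𝔤]`, as a linear subspace. -/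
abbrev derived : Submodule ℝ Lie54 :=
  (⁅(⊤ : LieIdeal ℝ Lie54), (⊤ : LieIdeal ℝ Lie54)⁆ : LieIdeal ℝ Lie54).toSubmodule

/-- The function `C(ξ) = 2 ξ₁ ξ₅ - 2 ξ₂ ξ₄ + ξ₃ ^ 2`, where `ξ_j = ⟨ξ, X_j⟩`. -/
def C (ξ : DualSp) : ℝ := 2 * ξ (X 0) * ξ (X 4) - 2 * ξ (X 1) * ξ (X 3) + ξ (X 2) ^ 2

/-- The linear subspace `{ξ ∘ ad x | x ∈ 𝔤}` of `𝔤*`: the tangent space at `ξ` of the coadjoint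
orbit of `ξ`. Its dimension is the dimension of that orbit. -/
def orbitTangent (ξ : DualSp) : Submodule ℝ DualSp :=
  Submodule.span ℝ (Set.range fun x : Lie54 =>
    ξ.comp (LinearMap.toContinuousLinearMap (LieAlgebra.ad ℝ Lie54 x)))

end Lie54

/-- The connected and simply connected nilpotent Lie group `G` with Lie algebra `𝔤 = Lie54`, in
exponential coordinates: the element `⟨x⟩` is `exp x`. -/
@[ext] structure Group54 : Type where
  log : Lie54

namespace Group54

open Lie54

/-- The Baker–Campbell–Hausdorff series
`x + y + [x, y] / 2 + ([x, [x, y]] + [y, [y, x]]) / 12 + ⋯`; the omitted terms are combinations of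
brackets of at least four elements, which vanish in `𝔤`. -/
def bch (x y : Lie54) : Lie54 :=
  x + y + (1 / 2 : ℝ) • ⁅x, y⁆ + (1 / 12 : ℝ) • (⁅x, ⁅x, y⁆⁆ + ⁅y, ⁅y, x⁆⁆)

instance : Mul Group54 := ⟨fun g h => ⟨bch g.log h.log⟩⟩
instance : One Group54 := ⟨⟨0⟩⟩
instance : Inv Group54 := ⟨fun g => ⟨-g.log⟩⟩

@[simp] theorem mul_log (g h : Group54) : (g * h).log = bch g.log h.log := rfl
@[simp] theorem one_log : (1 : Group54).log = 0 := rfl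
@[simp] theorem inv_log (g : Group54) : (g⁻¹).log = -g.log := rfl

instance : Group Group54 := Group.ofLeftAxioms
  (by
    intro a b c
    apply Group54.ext
    apply ext5 <;>
      simp only [mul_log, one_log, inv_log, bch, add_apply, Lie54.smul_apply, neg_apply,
      zero_apply, lie_apply_0, lie_apply_1, lie_apply_2, lie_apply_3, lie_apply_4] <;>
      ring)
  (by
    intro a
    apply Group54.ext
    apply ext5 <;>
      simp only [mul_log, one_log, inv_log, bch, add_apply, Lie54.smul_apply, neg_apply,
      zero_apply, lie_apply_0, lie_apply_1, lie_apply_2, lie_apply_3, lie_apply_4] <;>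
      ring)
  (by
    intro a
    apply Group54.ext
    apply ext5 <;>
      simp only [mul_log, one_log, inv_log, bch, add_apply, Lie54.smul_apply, neg_apply,
      zero_apply, lie_apply_0, lie_apply_1, lie_apply_2, lie_apply_3, lie_apply_4] <;>
      ring)

/-- The adjoint action of `G` on `𝔤`: `Ad (exp x) = e ^ (ad x) = 1 + ad x + (ad x) ^ 2 / 2`, where
the exponential series stops because `(ad x) ^ 3 = 0`. -/
def Ad (g : Group54) : Module.End ℝ Lie54 :=
  1 + LieAlgebra.ad ℝ Lie54 g.log + (1 / 2 : ℝ) • LieAlgebra.ad ℝ Lie54 g.log ^ 2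

theorem Ad_apply (g : Group54) (y : Lie54) :
    Ad g y = y + ⁅g.log, y⁆ + (1 / 2 : ℝ) • ⁅g.log, ⁅g.log, y⁆⁆ := by
  simp [Ad, pow_two]

theorem Ad_one : Ad 1 = 1 := by
  apply LinearMap.ext
  intro y
  simp [Ad_apply]

theorem Ad_mul (g h : Group54) : Ad (g * h) = Ad g * Ad h := by
  apply LinearMap.ext
  intro y
  rw [Module.End.mul_apply, Ad_apply, Ad_apply, Ad_apply]
  apply ext5 <;>
      simp only [mul_log, one_log, inv_log, bch, add_apply, Lie54.smul_apply, neg_apply,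
      zero_apply, lie_apply_0, lie_apply_1, lie_apply_2, lie_apply_3, lie_apply_4] <;>
      ring

/-- The coadjoint action of `G` on `𝔤*`: `g • ξ = ξ ∘ Ad g⁻¹`. -/
instance : MulAction Group54 DualSp where
  smul g ξ := ξ.comp (LinearMap.toContinuousLinearMap (Ad g⁻¹))
  one_smul ξ := by
    change ξ.comp (LinearMap.toContinuousLinearMap (Ad 1⁻¹)) = ξ
    ext y
    simp [Ad_one]
  mul_smul g h ξ := by
    change ξ.comp (LinearMap.toContinuousLinearMap (Ad (g * h)⁻¹)) =
      (ξ.comp (LinearMap.toContinuousLinearMap (Ad h⁻¹))).comp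
        (LinearMap.toContinuousLinearMap (Ad g⁻¹))
    ext y
    simp [Ad_mul]

theorem coadjoint_apply (g : Group54) (ξ : DualSp) (y : Lie54) : (g • ξ) y = ξ (Ad g⁻¹ y) := rfl

theorem lie_mem_derived (x y : Lie54) : ⁅x, y⁆ ∈ derived :=
  LieSubmodule.lie_mem_lie (LieSubmodule.mem_top x) (LieSubmodule.mem_top y)

theorem smul_mem_annihilator (g : Group54) {ξ : DualSp} (h : ξ ∈ annihilator derived) :
    g • ξ ∈ annihilator derived := by
  intro x hx
  rw [coadjoint_apply, Ad_apply]
  apply h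
  exact add_mem (add_mem hx (lie_mem_derived _ _)) (Submodule.smul_mem _ _ (lie_mem_derived _ _))

/-- The `G`-invariant set `𝔤* \ [𝔤, 𝔤]^⊥`, with the restricted coadjoint action. -/
def regular : SubMulAction Group54 DualSp where
  carrier := (annihilator derived)ᶜ
  smul_mem' g ξ h := fun h' => h (by simpa using smul_mem_annihilator g⁻¹ h')

/-- The orbit space `(𝔤* \ [𝔤, 𝔤]^⊥) / G`, with the quotient topology. -/
abbrev OrbitSpace : Type := MulAction.orbitRel.Quotient Group54 regular

/-- The quotient map `q : 𝔤* \ [𝔤, 𝔤]^⊥ → (𝔤* \ [𝔤, 𝔤]^⊥) / G`, `ξ ↦ Gξ`. -/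
def toOrbit (ξ : regular) : OrbitSpace := Quotient.mk (MulAction.orbitRel Group54 regular) ξ

/-- A point of the orbit space, regarded as a subset of `𝔤*`. -/
def orbitSet (O : OrbitSpace) : Set DualSp := Subtype.val '' O.orbit

/-- The set `((𝔷* \ {0}) × ℝ) ∪ ({0} × (0, ∞))`, an open subset of `𝔷* × ℝ`. The second piece is
needed because the map to be studied has first component `0` on the orbits contained in `𝔷^⊥`. -/
def target : Set (StrongDual ℝ centre × ℝ) := {p | p.1 ≠ 0 ∨ 0 < p.2}

end Group54

end

/-! Write ξ_j for `ξ (X (j - 1))`. The group fixes ξ₁ and ξ₂ and acts on (ξ₃, ξ₄, ξ₅) by polynomial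
formulas (`mk_neg_smul`), from which the invariance of C is a direct computation. Everything else is
governed by v = (ξ₃, -ξ₂, ξ₁), which vanishes exactly on [𝔤, 𝔤]^⊥. Up to a factor 2 it is the
gradient of C in the last three coordinates, and the tangent space of the orbit is its orthogonal
complement there.

Hence (ξ|_𝔷, C) is a submersion off [𝔤, 𝔤]^⊥ (`map_nhds_restrictC`), which makes Ψ open.

For the fibres, suppose first (ξ₁, ξ₂) ≠ 0. Then ξ₃ can be moved to any value, equality of C forces
the remaining defect in (ξ₄, ξ₅) to be parallel to (ξ₁, ξ₂), and the `X 2` direction of the group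
removes it (`exists_smul_eq`). If ξ₁ = ξ₂ = 0, then ξ₃ is invariant, (ξ₄, ξ₅) is arbitrary on the
orbit, and C = ξ₃² forgets only the sign of ξ₃. -/

namespace Lie54

/-! ### Coordinates on 𝔤 and 𝔤* -/

theorem eq_sum_X (x : Lie54) :
    x = x 0 • X 0 + x 1 • X 1 + x 2 • X 2 + x 3 • X 3 + x 4 • X 4 := by
  apply ext5 <;> simp [X]

theorem dual_apply (ξ : DualSp) (x : Lie54) :
    ξ x = x 0 * ξ (X 0) + x 1 * ξ (X 1) + x 2 * ξ (X 2) + x 3 * ξ (X 3) + x 4 * ξ (X 4) := by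
  conv_lhs => rw [eq_sum_X x]
  simp only [map_add, map_smul, smul_eq_mul]

theorem dual_ext {ξ η : DualSp} (h0 : ξ (X 0) = η (X 0)) (h1 : ξ (X 1) = η (X 1))
    (h2 : ξ (X 2) = η (X 2)) (h3 : ξ (X 3) = η (X 3)) (h4 : ξ (X 4) = η (X 4)) : ξ = η := by
  ext x
  rw [dual_apply ξ, dual_apply η, h0, h1, h2, h3, h4]

/-- The functional with prescribed values on the basis `X₁, …, X₅`. -/
noncomputable def ofCoords (a b c d e : ℝ) : DualSp :=
  LinearMap.toContinuousLinearMap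
    { toFun := fun x : Lie54 => x 0 * a + x 1 * b + x 2 * c + x 3 * d + x 4 * e
      map_add' := fun x y => by simp only [add_apply]; ring
      map_smul' := fun r x => by simp only [Lie54.smul_apply, smul_eq_mul, RingHom.id_apply]; ring }

theorem ofCoords_apply (a b c d e : ℝ) (x : Lie54) :
    ofCoords a b c d e x = x 0 * a + x 1 * b + x 2 * c + x 3 * d + x 4 * e := rfl

@[simp] theorem ofCoords_X0 (a b c d e : ℝ) : ofCoords a b c d e (X 0) = a := by
  simp [ofCoords_apply, X]
@[simp] theorem ofCoords_X1 (a b c d e : ℝ) : ofCoords a b c d e (X 1) = b := by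
  simp [ofCoords_apply, X]
@[simp] theorem ofCoords_X2 (a b c d e : ℝ) : ofCoords a b c d e (X 2) = c := by
  simp [ofCoords_apply, X]
@[simp] theorem ofCoords_X3 (a b c d e : ℝ) : ofCoords a b c d e (X 3) = d := by
  simp [ofCoords_apply, X]
@[simp] theorem ofCoords_X4 (a b c d e : ℝ) : ofCoords a b c d e (X 4) = e := by
  simp [ofCoords_apply, X]

/-! ### The centre, the derived algebra and their annihilators -/

theorem mem_centre_iff (x : Lie54) : x ∈ centre ↔ x 2 = 0 ∧ x 3 = 0 ∧ x 4 = 0 := by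
  change x ∈ LieAlgebra.center ℝ Lie54 ↔ _
  rw [LieModule.mem_maxTrivSubmodule]
  constructor
  · intro h
    have h2 := congrFun (h (X 2))
    have h3 := congrFun (h (X 3))
    refine ⟨?_, ?_, ?_⟩
    · simpa [X] using h3 0
    · simpa [X] using h2 0
    · simpa [X] using h2 1
  · rintro ⟨h2, h3, h4⟩ y
    apply ext5 <;> simp [h2, h3, h4]

theorem X0_mem_centre : X 0 ∈ centre := (mem_centre_iff _).2 (by simp [X])

theorem X1_mem_centre : X 1 ∈ centre := (mem_centre_iff _).2 (by simp [X])

theorem centre_eq_sum (z : centre) :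
    z = z.1 0 • (⟨X 0, X0_mem_centre⟩ : centre) + z.1 1 • (⟨X 1, X1_mem_centre⟩ : centre) := by
  obtain ⟨h2, h3, h4⟩ := (mem_centre_iff _).1 z.2
  apply Subtype.ext
  apply ext5 <;> simp [X, h2, h3, h4]

theorem centre_dual_ext {ζ ω : StrongDual ℝ centre}
    (h0 : ζ ⟨X 0, X0_mem_centre⟩ = ω ⟨X 0, X0_mem_centre⟩)
    (h1 : ζ ⟨X 1, X1_mem_centre⟩ = ω ⟨X 1, X1_mem_centre⟩) : ζ = ω := by
  ext z
  rw [centre_eq_sum z]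
  simp only [map_add, map_smul, h0, h1]

theorem mem_annihilator_centre_iff (ξ : DualSp) :
    ξ ∈ annihilator centre ↔ ξ (X 0) = 0 ∧ ξ (X 1) = 0 := by
  constructor
  · intro h
    exact ⟨h _ X0_mem_centre, h _ X1_mem_centre⟩
  · rintro ⟨h0, h1⟩ x hx
    obtain ⟨h2, h3, h4⟩ := (mem_centre_iff x).1 hx
    rw [dual_apply, h0, h1, h2, h3, h4]
    ring

theorem mem_annihilator_derived_iff (ξ : DualSp) :
    ξ ∈ annihilator derived ↔ ξ (X 0) = 0 ∧ ξ (X 1) = 0 ∧ ξ (X 2) = 0 := by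
  constructor
  · intro h
    refine ⟨h _ ?_, h _ ?_, h _ ?_⟩
    · rw [← lie_X3_X2]; exact Group54.lie_mem_derived _ _
    · rw [← lie_X4_X2]; exact Group54.lie_mem_derived _ _
    · rw [← lie_X4_X3]; exact Group54.lie_mem_derived _ _
  · rintro ⟨h0, h1, h2⟩ x hx
    have hle : derived ≤ LinearMap.ker (ξ : Lie54 →ₗ[ℝ] ℝ) := by
      intro y hy
      have hy' : y ∈ ⁅(⊤ : LieIdeal ℝ Lie54), (⊤ : LieIdeal ℝ Lie54)⁆ := hy
      rw [← LieSubmodule.mem_toSubmodule, LieSubmodule.lieIdeal_oper_eq_linear_span'] at hy'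
      refine (Submodule.span_le.2 ?_) hy'
      rintro _ ⟨u, -, v, -, rfl⟩
      change ξ ⁅u, v⁆ = 0
      rw [dual_apply, h0, h1, h2]
      simp
    exact hle hx

theorem not_mem_annihilator_derived_iff (ξ : DualSp) :
    ξ ∉ annihilator derived ↔ 0 < ξ (X 0) ^ 2 + ξ (X 1) ^ 2 + ξ (X 2) ^ 2 := by
  rw [mem_annihilator_derived_iff]
  constructor
  · intro h
    by_contra hn
    apply h
    have h0 := sq_nonneg (ξ (X 0))
    have h1 := sq_nonneg (ξ (X 1))
    have h2 := sq_nonneg (ξ (X 2))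
    exact ⟨pow_eq_zero_iff two_ne_zero |>.1 (by linarith),
      pow_eq_zero_iff two_ne_zero |>.1 (by linarith),
      pow_eq_zero_iff two_ne_zero |>.1 (by linarith)⟩
  · rintro h ⟨h0, h1, h2⟩
    simp [h0, h1, h2] at h

/-! ### Dimension of the orbits -/

/-- The value at `x` of the infinitesimal coadjoint action on `ξ`. -/
theorem comp_ad (ξ : DualSp) (x : Lie54) :
    ξ.comp (LinearMap.toContinuousLinearMap (LieAlgebra.ad ℝ Lie54 x)) =
      ofCoords 0 0 (ξ (X 0) * x 3 + ξ (X 1) * x 4) (ξ (X 2) * x 4 - ξ (X 0) * x 2)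
        (-(ξ (X 1) * x 2) - ξ (X 2) * x 3) := by
  ext y
  change ξ ⁅x, y⁆ = _
  rw [dual_apply, ofCoords_apply]
  simp only [lie_apply_0, lie_apply_1, lie_apply_2, lie_apply_3, lie_apply_4]
  ring

theorem orbitTangent_eq_bot {ξ : DualSp} (h : ξ ∈ annihilator derived) : orbitTangent ξ = ⊥ := by
  obtain ⟨h0, h1, h2⟩ := (mem_annihilator_derived_iff ξ).1 h
  rw [orbitTangent, Submodule.span_eq_bot]
  rintro _ ⟨x, rfl⟩
  dsimp only
  rw [comp_ad, h0, h1, h2]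
  apply dual_ext <;> simp

/-- By `comp_ad`, the tangent vectors are the cross products of (x₃, x₄, x₅) with v = (ξ₃, -ξ₂, ξ₁),
and the cross product with a nonzero vector has rank 2. -/
theorem finrank_orbitTangent {ξ : DualSp} (h : ξ ∉ annihilator derived) :
    Module.finrank ℝ (orbitTangent ξ) = 2 := by
  have mem (x : Lie54) : ofCoords 0 0 (ξ (X 0) * x 3 + ξ (X 1) * x 4)
      (ξ (X 2) * x 4 - ξ (X 0) * x 2) (-(ξ (X 1) * x 2) - ξ (X 2) * x 3) ∈ orbitTangent ξ := by
    rw [← comp_ad]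
    exact Submodule.subset_span ⟨x, rfl⟩
  have key (u v : DualSp) (hu : u ∈ orbitTangent ξ) (hv : v ∈ orbitTangent ξ)
      (hspan : ∀ x : Lie54, ∃ r s : ℝ, r • u + s • v =
        ofCoords 0 0 (ξ (X 0) * x 3 + ξ (X 1) * x 4)
          (ξ (X 2) * x 4 - ξ (X 0) * x 2) (-(ξ (X 1) * x 2) - ξ (X 2) * x 3))
      (hli : ∀ r s : ℝ, r • u + s • v = 0 → r = 0 ∧ s = 0) :
      Module.finrank ℝ (orbitTangent ξ) = 2 := by
    have hE : orbitTangent ξ = Submodule.span ℝ (Set.range ![u, v]) := by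
      apply le_antisymm
      · refine Submodule.span_le.2 ?_
        rintro _ ⟨x, rfl⟩
        dsimp only
        rw [comp_ad]
        obtain ⟨r, s, hrs⟩ := hspan x
        rw [← hrs]
        exact add_mem (Submodule.smul_mem _ _ (Submodule.subset_span ⟨0, rfl⟩))
          (Submodule.smul_mem _ _ (Submodule.subset_span ⟨1, rfl⟩))
      · refine Submodule.span_le.2 ?_
        rintro _ ⟨i, rfl⟩
        fin_cases i
        exacts [hu, hv]
    rw [hE, finrank_span_eq_card (LinearIndependent.pair_iff.2 hli)]
    simp
  have cf {r s : ℝ} {u v w : DualSp} (h : r • u + s • v = w) (i : Fin 5) :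
      r * u (X i) + s * v (X i) = w (X i) := by
    rw [← h]; rfl
  -- The kernel of the cross product is spanned by v, so a basis vector at which v has a nonzero
  -- entry can be eliminated. The coefficients below come from this elimination.
  by_cases h0 : ξ (X 0) = 0
  · by_cases h1 : ξ (X 1) = 0
    · have h2 : ξ (X 2) ≠ 0 := fun h2 => h ((mem_annihilator_derived_iff ξ).2 ⟨h0, h1, h2⟩)
      refine key _ _ (mem (X 3)) (mem (X 4)) (fun x => ⟨x 3, x 4, ?_⟩) (fun r s hrs => ?_)
      · apply dual_ext <;> simp [X, h0, h1] <;> ring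
      · have e3 := cf hrs 3
        have e4 := cf hrs 4
        simp [X, h0, h1, h2] at e3 e4
        exact ⟨e4, e3⟩
    · refine key _ _ (mem (X 2)) (mem (X 4))
        (fun x => ⟨x 2 + ξ (X 2) / ξ (X 1) * x 3, x 4, ?_⟩) (fun r s hrs => ?_)
      · apply dual_ext <;> simp [X, h0] <;> field_simp; ring
      · have e2 := cf hrs 2
        have e4 := cf hrs 4
        simp [X, h0, h1] at e2 e4
        exact ⟨e4, e2⟩
  · refine key _ _ (mem (X 2)) (mem (X 3))
      (fun x => ⟨x 2 - ξ (X 2) / ξ (X 0) * x 4, x 3 + ξ (X 1) / ξ (X 0) * x 4, ?_⟩)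
      (fun r s hrs => ?_)
    · apply dual_ext <;> simp [X] <;> field_simp <;> ring
    · have e2 := cf hrs 2
      have e3 := cf hrs 3
      simp [X, h0] at e2
      simp [X, h0, e2] at e3
      exact ⟨e3, e2⟩

/-! ### The submersion (ξ|_𝔷, C) -/

/-- Restriction to the centre together with the invariant `C`, before passing to orbits. -/
noncomputable def restrictC (ξ : DualSp) : StrongDual ℝ centre × ℝ := (ξ.comp centre.subtypeL, C ξ)

/-- The restriction map `𝔤* → 𝔷*`. -/
noncomputable def restrictL : DualSp →L[ℝ] StrongDual ℝ centre :=
  ContinuousLinearMap.precomp ℝ centre.subtypeL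

theorem restrictC_eq_iff (ξ η : DualSp) :
    restrictC ξ = restrictC η ↔ ξ (X 0) = η (X 0) ∧ ξ (X 1) = η (X 1) ∧ C ξ = C η := by
  constructor
  · intro h
    have h1 : ξ.comp centre.subtypeL = η.comp centre.subtypeL := congrArg Prod.fst h
    exact ⟨DFunLike.congr_fun h1 ⟨X 0, X0_mem_centre⟩, DFunLike.congr_fun h1 ⟨X 1, X1_mem_centre⟩,
      congrArg Prod.snd h⟩
  · rintro ⟨h0, h1, hC⟩
    exact Prod.ext (centre_dual_ext h0 h1) hC

/-- Evaluation at a vector, as a continuous linear functional on `𝔤*`. -/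
noncomputable abbrev evalL (x : Lie54) : DualSp →L[ℝ] ℝ := ContinuousLinearMap.apply ℝ ℝ x

/-- The differential of `C` at `ξ`. -/
noncomputable def fderivC (ξ : DualSp) : DualSp →L[ℝ] ℝ :=
  (2 * ξ (X 0)) • evalL (X 4) + (2 * ξ (X 4)) • evalL (X 0)
    - ((2 * ξ (X 1)) • evalL (X 3) + (2 * ξ (X 3)) • evalL (X 1))
    + (2 * ξ (X 2)) • evalL (X 2)

theorem fderivC_apply (ξ η : DualSp) :
    fderivC ξ η = 2 * ξ (X 0) * η (X 4) + 2 * ξ (X 4) * η (X 0)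
      - (2 * ξ (X 1) * η (X 3) + 2 * ξ (X 3) * η (X 1)) + 2 * ξ (X 2) * η (X 2) := rfl

theorem hasStrictFDerivAt_C (ξ : DualSp) : HasStrictFDerivAt C (fderivC ξ) ξ := by
  have hE (i : Fin 5) : HasStrictFDerivAt (fun η : DualSp => η (X i)) (evalL (X i)) ξ :=
    (evalL (X i)).hasStrictFDerivAt
  have := ((((hE 0).const_mul 2).mul (hE 4)).sub (((hE 1).const_mul 2).mul (hE 3))).add
    ((hE 2).pow 2)
  refine this.congr_fderiv ?_
  ext η
  simp [fderivC_apply]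
  ring

theorem hasStrictFDerivAt_restrictC (ξ : DualSp) :
    HasStrictFDerivAt restrictC (restrictL.prod (fderivC ξ)) ξ := by
  have h := HasStrictFDerivAt.prodMk (𝕜 := ℝ) (E := DualSp) (F := StrongDual ℝ centre) (G := ℝ)
    (f₁ := fun η => restrictL η) (x := ξ) restrictL.hasStrictFDerivAt (hasStrictFDerivAt_C ξ)
  exact h

theorem map_nhds_restrictC {ξ : DualSp} (h : ξ ∉ annihilator derived) :
    Filter.map restrictC (nhds ξ) = nhds (restrictC ξ) := by
  rw [not_mem_annihilator_derived_iff] at h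
  refine HasStrictFDerivAt.map_nhds_eq_of_surj (𝕜 := ℝ) (E := DualSp)
    (F := StrongDual ℝ centre × ℝ) (f' := restrictL.prod (fderivC ξ))
    (hasStrictFDerivAt_restrictC ξ) (LinearMap.range_eq_top.2 ?_)
  rintro ⟨ζ, t⟩
  set a := ζ ⟨X 0, X0_mem_centre⟩
  set b := ζ ⟨X 1, X1_mem_centre⟩
  -- The preimage has first coordinates a, b and continues with s • v; dC takes the value 2s|v|² on
  -- that last part, so s is solved from the value t.
  set s := (t - 2 * ξ (X 4) * a + 2 * ξ (X 3) * b) /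
    (2 * (ξ (X 0) ^ 2 + ξ (X 1) ^ 2 + ξ (X 2) ^ 2)) with hs
  refine ⟨ofCoords a b (s * ξ (X 2)) (-(s * ξ (X 1))) (s * ξ (X 0)), Prod.ext ?_ ?_⟩
  · apply centre_dual_ext
    · exact ofCoords_X0 ..
    · exact ofCoords_X1 ..
  · have : s * (2 * (ξ (X 0) ^ 2 + ξ (X 1) ^ 2 + ξ (X 2) ^ 2)) =
        t - 2 * ξ (X 4) * a + 2 * ξ (X 3) * b := by
      rw [hs]; field_simp
    change fderivC ξ _ = t
    rw [fderivC_apply, ofCoords_X0, ofCoords_X1, ofCoords_X2, ofCoords_X3, ofCoords_X4]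
    linear_combination this

theorem continuous_restrictC : Continuous restrictC :=
  continuous_iff_continuousAt.2 fun ξ => (hasStrictFDerivAt_restrictC ξ).continuousAt

theorem isOpen_compl_annihilator_derived : IsOpen (annihilator derived)ᶜ := by
  have : (annihilator derived)ᶜ =
      {ξ : DualSp | 0 < ξ (X 0) ^ 2 + ξ (X 1) ^ 2 + ξ (X 2) ^ 2} :=
    Set.ext not_mem_annihilator_derived_iff
  rw [this]
  have hE (i : Fin 5) : Continuous (fun η : DualSp => η (X i)) := (evalL (X i)).continuous
  exact isOpen_lt continuous_const ((((hE 0).pow 2).add ((hE 1).pow 2)).add ((hE 2).pow 2))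

theorem C_neg (ξ : DualSp) : C (-ξ) = C ξ := by
  simp [C]

end Lie54

/-! ### The coadjoint action and the separation of orbits -/

namespace Group54

open Lie54

/-- The coadjoint action in coordinates. -/
theorem mk_neg_smul (x : Lie54) (ξ : DualSp) :
    (⟨-x⟩ : Group54) • ξ = ofCoords (ξ (X 0)) (ξ (X 1))
      (ξ (X 2) + ξ (X 0) * x 3 + ξ (X 1) * x 4)
      (ξ (X 3) - ξ (X 0) * x 2 + ξ (X 2) * x 4 + x 4 * (ξ (X 0) * x 3 + ξ (X 1) * x 4) / 2)
      (ξ (X 4) - ξ (X 1) * x 2 - ξ (X 2) * x 3 - x 3 * (ξ (X 0) * x 3 + ξ (X 1) * x 4) / 2) := by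
  ext y
  rw [coadjoint_apply, Ad_apply, inv_log, neg_neg, dual_apply, ofCoords_apply]
  simp only [add_apply, Lie54.smul_apply, lie_apply_0, lie_apply_1, lie_apply_2, lie_apply_3,
    lie_apply_4]
  ring

/-- Allows use of `mk_neg_smul`, which is stated at exp(-x) because there the action is composition
with Ad(exp x). -/
theorem exists_eq_mk_neg (g : Group54) : ∃ x : Lie54, g = ⟨-x⟩ :=
  ⟨-g.log, by rw [neg_neg]⟩

theorem smul_X0 (g : Group54) (ξ : DualSp) : (g • ξ) (X 0) = ξ (X 0) := by
  obtain ⟨x, rfl⟩ := exists_eq_mk_neg g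
  simp [mk_neg_smul]

theorem smul_X1 (g : Group54) (ξ : DualSp) : (g • ξ) (X 1) = ξ (X 1) := by
  obtain ⟨x, rfl⟩ := exists_eq_mk_neg g
  simp [mk_neg_smul]

theorem smul_X2 (g : Group54) {ξ : DualSp} (h0 : ξ (X 0) = 0) (h1 : ξ (X 1) = 0) :
    (g • ξ) (X 2) = ξ (X 2) := by
  obtain ⟨x, rfl⟩ := exists_eq_mk_neg g
  simp [mk_neg_smul, h0, h1]

theorem C_smul (g : Group54) (ξ : DualSp) : C (g • ξ) = C ξ := by
  obtain ⟨x, rfl⟩ := exists_eq_mk_neg g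
  simp only [mk_neg_smul, C, ofCoords_X0, ofCoords_X1, ofCoords_X2, ofCoords_X3, ofCoords_X4]
  ring

theorem smul_neg' (g : Group54) (ξ : DualSp) : g • (-ξ) = -(g • ξ) := rfl

theorem restrictC_smul (g : Group54) (ξ : DualSp) : restrictC (g • ξ) = restrictC ξ :=
  (restrictC_eq_iff _ _).2 ⟨smul_X0 g ξ, smul_X1 g ξ, C_smul g ξ⟩

/-- The orbits which are not contained in `𝔷^⊥` are separated by `ξ|_𝔷` and `C`. -/
theorem exists_smul_eq {ξ η : DualSp} (h : restrictC ξ = restrictC η)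
    (hξ : ξ ∉ annihilator centre) : ∃ g : Group54, g • ξ = η := by
  obtain ⟨h0, h1, hC⟩ := (restrictC_eq_iff _ _).1 h
  rw [mem_annihilator_centre_iff] at hξ
  simp only [C, ← h0, ← h1] at hC
  generalize ha : ξ (X 0) = a at *
  generalize hb : ξ (X 1) = b at *
  have hn : a ^ 2 + b ^ 2 ≠ 0 := by
    intro hn
    exact hξ ⟨by nlinarith [sq_nonneg a, sq_nonneg b], by nlinarith [sq_nonneg a, sq_nonneg b]⟩
  obtain ⟨p, q, hpq⟩ : ∃ p q : ℝ, a * p + b * q = η (X 2) - ξ (X 2) :=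
    ⟨a * (η (X 2) - ξ (X 2)) / (a ^ 2 + b ^ 2), b * (η (X 2) - ξ (X 2)) / (a ^ 2 + b ^ 2), by
      field_simp⟩
  -- r and s are the defects left in ξ₄ and ξ₅ once p and q have matched ξ₃.
  obtain ⟨r, hr⟩ : ∃ r, r = η (X 3) - ξ (X 3) - ξ (X 2) * q - q * (a * p + b * q) / 2 := ⟨_, rfl⟩
  obtain ⟨s, hs⟩ : ∃ s, s = η (X 4) - ξ (X 4) + ξ (X 2) * p + p * (a * p + b * q) / 2 := ⟨_, rfl⟩
  have hrs : a * s = b * r := by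
    have hc : η (X 2) = ξ (X 2) + (a * p + b * q) := by linear_combination -hpq
    rw [hc] at hC
    rw [hr, hs]
    linear_combination -hC / 2
  -- (r, s) is parallel to (a, b) by `hrs`; -m is its projection coefficient.
  obtain ⟨m, hma, hmb⟩ : ∃ m : ℝ, r = -(a * m) ∧ s = -(b * m) := by
    refine ⟨-(a * r + b * s) / (a ^ 2 + b ^ 2), ?_, ?_⟩
    · field_simp
      linear_combination -b * hrs
    · field_simp
      linear_combination a * hrs
  have hx : ∃ x : Lie54, x 2 = m ∧ x 3 = p ∧ x 4 = q :=
    ⟨m • X 2 + p • X 3 + q • X 4, by simp [X], by simp [X], by simp [X]⟩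
  obtain ⟨x, hx2, hx3, hx4⟩ := hx
  refine ⟨⟨-x⟩, ?_⟩
  rw [mk_neg_smul, hx2, hx3, hx4]
  apply dual_ext
  · simp [ha, h0]
  · simp [hb, h1]
  · simp only [ofCoords_X2, ha, hb]; linear_combination hpq
  · simp only [ofCoords_X3, ha, hb]; linear_combination -hma + hr
  · simp only [ofCoords_X4, ha, hb]; linear_combination -hmb + hs

/-- On 𝔷^⊥ the action translates (ξ₄, ξ₅) by ξ₃ • (x₅, -x₄), hence reaches every point when ξ₃ ≠ 0.
-/
theorem exists_smul_eq_of_mem {ξ η : DualSp} (hξ : ξ ∈ annihilator centre)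
    (hη : η ∈ annihilator centre) (h2 : ξ (X 2) = η (X 2)) (hne : ξ (X 2) ≠ 0) :
    ∃ g : Group54, g • ξ = η := by
  obtain ⟨ha, hb⟩ := (mem_annihilator_centre_iff ξ).1 hξ
  obtain ⟨ha', hb'⟩ := (mem_annihilator_centre_iff η).1 hη
  have hx : ∃ x : Lie54, x 3 = (ξ (X 4) - η (X 4)) / ξ (X 2) ∧
      x 4 = (η (X 3) - ξ (X 3)) / ξ (X 2) :=
    ⟨((ξ (X 4) - η (X 4)) / ξ (X 2)) • X 3 + ((η (X 3) - ξ (X 3)) / ξ (X 2)) • X 4,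
      by simp [X], by simp [X]⟩
  obtain ⟨x, hx3, hx4⟩ := hx
  refine ⟨⟨-x⟩, ?_⟩
  rw [mk_neg_smul, hx3, hx4, ha, hb]
  apply dual_ext
  · simp [ha']
  · simp [hb']
  · simp [h2]
  · simp only [ofCoords_X3]; field_simp; ring
  · simp only [ofCoords_X4]; field_simp; ring

/-! ### Orbits as points and as subsets of 𝔤* -/

theorem toOrbit_eq_iff (ξ η : regular) :
    toOrbit ξ = toOrbit η ↔ ∃ g : Group54, g • (η : DualSp) = ξ := by
  refine Quotient.eq.trans ?_
  constructor
  · rintro ⟨g, hg⟩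
    exact ⟨g, congrArg Subtype.val hg⟩
  · rintro ⟨g, hg⟩
    exact ⟨g, Subtype.ext hg⟩

theorem mem_orbitSet_toOrbit (ξ : regular) (η : DualSp) :
    η ∈ orbitSet (toOrbit ξ) ↔ ∃ g : Group54, g • (ξ : DualSp) = η := by
  constructor
  · rintro ⟨ω, hω, rfl⟩
    exact (toOrbit_eq_iff ω ξ).1 (MulAction.orbitRel.Quotient.mem_orbit.1 hω)
  · rintro ⟨g, rfl⟩
    exact ⟨g • ξ, MulAction.orbitRel.Quotient.mem_orbit.2 ((toOrbit_eq_iff _ _).2 ⟨g, rfl⟩), rfl⟩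

theorem orbitSet_subset_iff (ξ : regular) :
    orbitSet (toOrbit ξ) ⊆ annihilator centre ↔ (ξ : DualSp) ∈ annihilator centre := by
  constructor
  · exact fun h => h ((mem_orbitSet_toOrbit ξ ξ).2 ⟨1, one_smul _ _⟩)
  · intro h η hη
    obtain ⟨g, rfl⟩ := (mem_orbitSet_toOrbit ξ η).1 hη
    rw [mem_annihilator_centre_iff] at h ⊢
    rwa [smul_X0, smul_X1]

theorem neg_mem_regular {ξ : DualSp} (h : ξ ∈ regular) : -ξ ∈ regular := by
  have h' : ξ ∉ annihilator derived := h
  change -ξ ∉ annihilator derived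
  rw [not_mem_annihilator_derived_iff] at h' ⊢
  simpa using h'

theorem orbitSet_toOrbit_neg (ξ : regular) :
    orbitSet (toOrbit ⟨-ξ, neg_mem_regular ξ.2⟩) = -orbitSet (toOrbit ξ) := by
  ext η
  rw [Set.mem_neg, mem_orbitSet_toOrbit, mem_orbitSet_toOrbit]
  simp only [smul_neg', neg_eq_iff_eq_neg]

theorem restrictC_mem_target {ξ : DualSp} (h : ξ ∈ regular) : restrictC ξ ∈ target := by
  by_cases hz : ξ ∈ annihilator centre
  · right
    have h' : ξ ∉ annihilator derived := h
    rw [not_mem_annihilator_derived_iff] at h'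
    obtain ⟨h0, h1⟩ := (mem_annihilator_centre_iff ξ).1 hz
    simpa [restrictC, C, h0, h1] using h'
  · left
    intro h0
    exact hz fun x hx => DFunLike.congr_fun h0 ⟨x, hx⟩

theorem X2_ne_zero (ξ : regular) (h : (ξ : DualSp) ∈ annihilator centre) :
    (ξ : DualSp) (X 2) ≠ 0 := by
  intro h2
  obtain ⟨h0, h1⟩ := (mem_annihilator_centre_iff _).1 h
  exact ξ.2 ((mem_annihilator_derived_iff _).2 ⟨h0, h1, h2⟩)

/-! ### The map Ψ and its fibres -/

/-- The map `ξ ↦ (ξ|_𝔷, C ξ)` on `𝔤* \ [𝔤, 𝔤]^⊥`. -/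
noncomputable def psiLift (ξ : regular) : target := ⟨restrictC ξ, restrictC_mem_target ξ.2⟩

theorem continuous_psiLift : Continuous psiLift :=
  (continuous_restrictC.comp continuous_subtype_val).subtype_mk _

theorem isOpenMap_psiLift : IsOpenMap psiLift := by
  have h : IsOpenMap (Subtype.val ∘ psiLift) := by
    rw [isOpenMap_iff_nhds_le]
    intro ξ
    have hopen : IsOpen (regular : Set DualSp) := isOpen_compl_annihilator_derived
    have hcomp : (Subtype.val ∘ psiLift : regular → _) = restrictC ∘ Subtype.val := rfl
    rw [hcomp, ← Filter.map_map]
    have : Filter.map (Subtype.val : regular → DualSp) (nhds ξ) = nhds (ξ : DualSp) :=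
      hopen.isOpenEmbedding_subtypeVal.map_nhds_eq ξ
    rw [this, map_nhds_restrictC ξ.2]
    rfl
  intro U hU
  have hU' := (h U hU).preimage (continuous_subtype_val : Continuous (Subtype.val : target → _))
  rwa [Set.image_comp, Set.preimage_image_eq _ Subtype.val_injective] at hU'

theorem surjective_psiLift : Function.Surjective psiLift := by
  rintro ⟨⟨ζ, t⟩, ht⟩
  suffices ∃ ξ : DualSp, ξ ∈ regular ∧ restrictC ξ = (ζ, t) by
    obtain ⟨ξ, hξ, he⟩ := this
    exact ⟨⟨ξ, hξ⟩, Subtype.ext he⟩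
  by_cases hζ : ζ = 0
  · have ht' : 0 < t := ht.resolve_left fun h => h hζ
    refine ⟨ofCoords 0 0 √t 0 0, ?_, ?_⟩
    · refine (not_mem_annihilator_derived_iff _).2 ?_
      simpa [Real.sq_sqrt ht'.le] using ht'
    · refine Prod.ext (centre_dual_ext ?_ ?_) ?_
      · simp [restrictC, hζ]
      · simp [restrictC, hζ]
      · simp [restrictC, C, Real.sq_sqrt ht'.le]
  · obtain ⟨a, ha⟩ : ∃ a, a = ζ ⟨X 0, X0_mem_centre⟩ := ⟨_, rfl⟩
    obtain ⟨b, hb⟩ : ∃ b, b = ζ ⟨X 1, X1_mem_centre⟩ := ⟨_, rfl⟩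
    have hn : 0 < a ^ 2 + b ^ 2 := by
      by_contra hn
      apply hζ
      apply centre_dual_ext
      · rw [← ha]
        exact pow_eq_zero_iff two_ne_zero |>.1 (by linarith [sq_nonneg a, sq_nonneg b])
      · rw [← hb]
        exact pow_eq_zero_iff two_ne_zero |>.1 (by linarith [sq_nonneg a, sq_nonneg b])
    -- With ξ₃ = 0, taking (ξ₄, ξ₅) = k(-b, a) gives C = 2k(a² + b²), which determines k.
    refine ⟨ofCoords a b 0 (-(b * (t / (2 * (a ^ 2 + b ^ 2))))) (a * (t / (2 * (a ^ 2 + b ^ 2)))),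
      ?_, ?_⟩
    · refine (not_mem_annihilator_derived_iff _).2 ?_
      simpa using hn
    · refine Prod.ext (centre_dual_ext ?_ ?_) ?_
      · simp [restrictC, ha]
      · simp [restrictC, hb]
      · simp [restrictC, C]
        field_simp

/-- The map `Ψ` on the space of two-dimensional coadjoint orbits. -/
noncomputable def psi : OrbitSpace → target :=
  Quotient.lift psiLift fun ξ η h => by
    obtain ⟨g, rfl⟩ := h
    exact Subtype.ext (restrictC_smul g (η : DualSp))

theorem surjective_toOrbit : Function.Surjective toOrbit := Quotient.mk_surjective

theorem psi_eq_iff (ξ η : regular) :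
    psi (toOrbit η) = psi (toOrbit ξ) ↔ restrictC (η : DualSp) = restrictC (ξ : DualSp) :=
  Subtype.ext_iff

theorem continuous_psi : Continuous psi := continuous_psiLift.quotient_lift _

theorem isOpenMap_psi : IsOpenMap psi := by
  intro U hU
  have h : psi '' U = psiLift '' (toOrbit ⁻¹' U) := by
    rw [← Set.image_preimage_eq U surjective_toOrbit, Set.image_image,
      Set.image_preimage_eq U surjective_toOrbit]
    rfl
  rw [h]
  exact isOpenMap_psiLift _ (hU.preimage continuous_quotient_mk')

theorem surjective_psi : Function.Surjective psi := by
  intro p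
  obtain ⟨ξ, rfl⟩ := surjective_psiLift p
  exact ⟨toOrbit ξ, rfl⟩

theorem psi_fibre_of_not_mem (ξ : regular) (h : (ξ : DualSp) ∉ annihilator centre) :
    psi ⁻¹' {psi (toOrbit ξ)} = {toOrbit ξ} := by
  ext O
  obtain ⟨η, rfl⟩ := surjective_toOrbit O
  rw [Set.mem_preimage, Set.mem_singleton_iff, Set.mem_singleton_iff]
  refine ⟨fun he => ?_, fun he => by rw [he]⟩
  exact (toOrbit_eq_iff _ _).2 (exists_smul_eq ((psi_eq_iff _ _).1 he).symm h)

/-- Here C = ξ₃², so the fibre determines ξ₃ up to sign, and ξ₃ ≠ 0 determines the orbit within 𝔷^⊥.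
-/
theorem psi_fibre_of_mem (ξ : regular) (h : (ξ : DualSp) ∈ annihilator centre) :
    psi ⁻¹' {psi (toOrbit ξ)} = {toOrbit ξ, toOrbit ⟨-ξ, neg_mem_regular ξ.2⟩} := by
  have hne := X2_ne_zero ξ h
  obtain ⟨h0, h1⟩ := (mem_annihilator_centre_iff _).1 h
  have hneg : -(ξ : DualSp) ∈ annihilator centre := by
    rw [mem_annihilator_centre_iff]; simp [h0, h1]
  ext O
  obtain ⟨η, rfl⟩ := surjective_toOrbit O
  rw [Set.mem_preimage, Set.mem_singleton_iff, Set.mem_insert_iff, Set.mem_singleton_iff]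
  constructor
  · intro he
    obtain ⟨e0, e1, eC⟩ := (restrictC_eq_iff _ _).1 ((psi_eq_iff _ _).1 he)
    rw [h0] at e0
    rw [h1] at e1
    have hη := (mem_annihilator_centre_iff _).2 ⟨e0, e1⟩
    have hsq : (η : DualSp) (X 2) ^ 2 = (ξ : DualSp) (X 2) ^ 2 := by
      simpa only [C, h0, h1, e0, e1, mul_zero, zero_mul, sub_zero, zero_add] using eC
    rcases sq_eq_sq_iff_eq_or_eq_neg.1 hsq with h2 | h2
    · exact Or.inl ((toOrbit_eq_iff _ _).2 (exists_smul_eq_of_mem h hη h2.symm hne))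
    · exact Or.inr ((toOrbit_eq_iff _ _).2
        (exists_smul_eq_of_mem hneg hη (by rw [h2]; rfl) (neg_ne_zero.2 hne)))
  · rintro (he | he)
    · rw [he]
    · rw [he, psi_eq_iff, restrictC_eq_iff]
      simp [h0, h1, C_neg]

/-- ξ₃ is a nonzero invariant on these orbits and changes sign under negation. -/
theorem toOrbit_neg_ne (ξ : regular) (h : (ξ : DualSp) ∈ annihilator centre) :
    toOrbit ⟨-ξ, neg_mem_regular ξ.2⟩ ≠ toOrbit ξ := by
  have hne := X2_ne_zero ξ h
  obtain ⟨h0, h1⟩ := (mem_annihilator_centre_iff _).1 h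
  intro he
  obtain ⟨g, hg⟩ := (toOrbit_eq_iff _ _).1 he
  have h2 := smul_X2 g h0 h1
  rw [hg] at h2
  exact hne (self_eq_neg.1 h2.symm)

end Group54

open Lie54 Group54 in
theorem proposition7p5 :
    -- the function `C` is constant on every coadjoint orbit
    (∀ (g : Group54) (ξ : DualSp), C (g • ξ) = C ξ) ∧
    -- the orbits outside `[𝔤, 𝔤]^⊥` are exactly the two-dimensional ones
    (∀ ξ : DualSp, ξ ∉ annihilator derived ↔ Module.finrank ℝ (orbitTangent ξ) = 2) ∧
    -- the map `Ψ` is well defined, continuous, open and surjective, with the stated fibres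
    ∃ Ψ : OrbitSpace → target,
      (∀ ξ : regular, (Ψ (toOrbit ξ) : StrongDual ℝ centre × ℝ) =
        ((ξ : DualSp).comp centre.subtypeL, C (ξ : DualSp))) ∧
      Continuous Ψ ∧ IsOpenMap Ψ ∧ Function.Surjective Ψ ∧
      (∀ O : OrbitSpace, {O} ≠ Ψ ⁻¹' {Ψ O} ↔ orbitSet O ⊆ annihilator centre) ∧
      (∀ O : OrbitSpace, orbitSet O ⊆ annihilator centre →
        orbitSet '' (Ψ ⁻¹' {Ψ O}) = {orbitSet O, -orbitSet O}) := by
  refine ⟨C_smul, fun ξ => ⟨finrank_orbitTangent, fun h hξ => ?_⟩, psi, fun ξ => rfl,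
    continuous_psi, isOpenMap_psi, surjective_psi, fun O => ?_, fun O hO => ?_⟩
  · rw [orbitTangent_eq_bot hξ, finrank_bot] at h
    exact absurd h (by norm_num)
  · obtain ⟨ξ, rfl⟩ := surjective_toOrbit O
    rw [orbitSet_subset_iff]
    constructor
    · intro h
      by_contra hξ
      exact h (psi_fibre_of_not_mem ξ hξ).symm
    · intro h he
      rw [psi_fibre_of_mem ξ h] at he
      exact toOrbit_neg_ne ξ h (Set.mem_singleton_iff.1 (he ▸ Set.mem_insert_of_mem _ rfl))
  · obtain ⟨ξ, rfl⟩ := surjective_toOrbit O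
    rw [psi_fibre_of_mem ξ ((orbitSet_subset_iff ξ).1 hO), Set.image_pair, orbitSet_toOrbit_neg]
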